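/- Let $X$ be a complex Hilbert space, let $A$ be a closed densely defined linear operator in $X$ with adjoint $A^*$, and let $B$, $C$ be (possibly unbounded) self-adjoint operators in $X$. Let $H$ be the Hamiltonian operator matrix $$H=\begin{pmatrix} A & B\\ C & -A^*\end{pmatrix},\qquad \mathcal D(H)=(\mathcal D(A)\cap\mathcal D(C))\times(\mathcal D(B)\cap\mathcal D(A^*)),$$ $$H(x,y)=(Ax+By,\;Cx-A^*y),$$ acting in the Hilbert space $X\times X$, and assume that $H$ is densely defined. Let $J(x,y)=(y,-x)$ on $X\times X$. An operator $T$ in $X$ is accretive if $\operatorname{Re}(Tx,x)\ge 0$ for all $x\in\mathcal D(T)$, and maximal accretive if it is accretive and has no proper accretive extension. An operator $S$ is $T$-bounded if $\mathcal D(T)\subset\mathcal D(S)$ and there are $a,b\ge 0$ with $\|Sx\|\le a\|Tx\|+b\|x\|$ for all $x\in\mathcal D(T)$; its relative bound is the infimum of all $a\ge 0$ for which such a $b$ exists. Suppose that $\mathcal D(H)=\mathcal D(A)\times\mathcal D(A^*)$ and that $A$ or $-A$ is maximal accretive. Then $JH=(JH)^*$ (including equality of domains) if one of the following holds: 1. $C$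 is $A$-bounded with relative bound $<1$ and $B$ is $A^*$-bounded with relative bound $\le 1$; 2. $C$ is $A$-bounded with relative bound $\le 1$ and $B$ is $A^*$-bounded with relative bound $<1$. -/

import Mathlib

open scoped LinearPMap

noncomputable section

namespace HamiltonianMatrix

section Block

variable {X₁ X₂ : Type*} [NormedAddCommGroup X₁] [NormedSpace ℂ X₁]
  [NormedAddCommGroup X₂] [NormedSpace ℂ X₂]

/-- The subspace `p × q` of the product space `X₁ × X₂`; the product carries the `ℓ²` norm, so that
it is the Hilbert space direct sum when `X₁` and `X₂` are Hilbert spaces. -/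
def prodSubspace (p : Submodule ℂ X₁) (q : Submodule ℂ X₂) :
    Submodule ℂ (WithLp 2 (X₁ × X₂)) :=
  (p.prod q).comap (WithLp.linearEquiv 2 ℂ (X₁ × X₂)).toLinearMap

/-- The operator induced by the block operator matrix with rows `(A, B)` and `(C, D)`: its domain is
`(D(A) ∩ D(C)) × (D(B) ∩ D(D))` and it maps `(x₁, x₂)` to `(A x₁ + B x₂, C x₁ + D x₂)`. -/
def blockMatrix (A : X₁ →ₗ.[ℂ] X₁) (B : X₂ →ₗ.[ℂ] X₁) (C : X₁ →ₗ.[ℂ] X₂) (D : X₂ →ₗ.[ℂ] X₂) :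
    WithLp 2 (X₁ × X₂) →ₗ.[ℂ] WithLp 2 (X₁ × X₂) where
  domain := prodSubspace (A.domain ⊓ C.domain) (B.domain ⊓ D.domain)
  toFun :=
    { toFun := fun z => WithLp.toLp 2
        (A ⟨z.1.fst, z.2.1.1⟩ + B ⟨z.1.snd, z.2.2.1⟩, C ⟨z.1.fst, z.2.1.2⟩ + D ⟨z.1.snd, z.2.2.2⟩)
      map_add' := fun z w => by
        have hA := A.map_add ⟨z.1.fst, z.2.1.1⟩ ⟨w.1.fst, w.2.1.1⟩
        have hB := B.map_add ⟨z.1.snd, z.2.2.1⟩ ⟨w.1.snd, w.2.2.1⟩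
        have hC := C.map_add ⟨z.1.fst, z.2.1.2⟩ ⟨w.1.fst, w.2.1.2⟩
        have hD := D.map_add ⟨z.1.snd, z.2.2.2⟩ ⟨w.1.snd, w.2.2.2⟩
        rw [← WithLp.toLp_add, Prod.mk_add_mk, add_add_add_comm, add_add_add_comm (C _),
          ← hA, ← hB, ← hC, ← hD]
        rfl
      map_smul' := fun c z => by
        have hA := A.map_smul c ⟨z.1.fst, z.2.1.1⟩
        have hB := B.map_smul c ⟨z.1.snd, z.2.2.1⟩
        have hC := C.map_smul c ⟨z.1.fst, z.2.1.2⟩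
        have hD := D.map_smul c ⟨z.1.snd, z.2.2.2⟩
        rw [RingHom.id_apply, ← WithLp.toLp_smul, Prod.smul_mk, smul_add, smul_add,
          ← hA, ← hB, ← hC, ← hD]
        rfl }

end Block

section RelativeBound

variable {X Y Z : Type*} [NormedAddCommGroup X] [NormedSpace ℂ X] [NormedAddCommGroup Y]
  [NormedSpace ℂ Y] [NormedAddCommGroup Z] [NormedSpace ℂ Z]

/-- `D(T) ⊆ D(S)` and `‖S x‖ ≤ a ‖T x‖ + b ‖x‖` for all `x ∈ D(T)`. -/
def RelBoundedWith (S : X →ₗ.[ℂ] Y) (T : X →ₗ.[ℂ] Z) (a b : ℝ) : Prop :=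
  ∃ h : T.domain ≤ S.domain, ∀ x : T.domain,
    ‖S (Submodule.inclusion h x)‖ ≤ a * ‖T x‖ + b * ‖(x : X)‖

/-- `S` is `T`-bounded. -/
def IsRelBounded (S : X →ₗ.[ℂ] Y) (T : X →ₗ.[ℂ] Z) : Prop :=
  ∃ a b : ℝ, 0 ≤ a ∧ 0 ≤ b ∧ RelBoundedWith S T a b

/-- The relative bound of a `T`-bounded operator `S`: the infimum of the admissible constants `a`
(meaningful only together with `IsRelBounded S T`). -/
def relBound (S : X →ₗ.[ℂ] Y) (T : X →ₗ.[ℂ] Z) : ℝ :=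
  sInf {a : ℝ | 0 ≤ a ∧ ∃ b : ℝ, 0 ≤ b ∧ RelBoundedWith S T a b}

end RelativeBound

section Hilbert

variable {X : Type*} [NormedAddCommGroup X] [InnerProductSpace ℂ X]

/-- `Re ⟨T x, x⟩ ≥ 0` for all `x ∈ D(T)`. -/
def IsAccretive (T : X →ₗ.[ℂ] X) : Prop :=
  ∀ x : T.domain, 0 ≤ (inner ℂ (T x) (x : X)).re

/-- `T` is accretive and has no proper accretive extension. -/
def IsMaximalAccretive (T : X →ₗ.[ℂ] X) : Prop :=
  IsAccretive T ∧ ∀ S : X →ₗ.[ℂ] X, IsAccretive S → T ≤ S → S = T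

/-- The unit symplectic operator matrix, `J (x, y) = (y, -x)`. -/
def symplecticJ (X : Type*) [NormedAddCommGroup X] [InnerProductSpace ℂ X] :
    WithLp 2 (X × X) →ₗ[ℂ] WithLp 2 (X × X) where
  toFun z := WithLp.toLp 2 (z.snd, -z.fst)
  map_add' z w := by
    rw [← WithLp.toLp_add (p := 2) (z.snd, -z.fst), Prod.mk_add_mk, WithLp.add_snd, WithLp.add_fst,
      neg_add]
  map_smul' c z := by
    rw [RingHom.id_apply, ← WithLp.toLp_smul (p := 2) c (z.snd, -z.fst), Prod.smul_mk,
      WithLp.smul_snd, WithLp.smul_fst, smul_neg]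

variable [CompleteSpace X]

/-- The block operator matrix with rows `(A, B)` and `(C, -A*)`. -/
def hamiltonian (A B C : X →ₗ.[ℂ] X) : WithLp 2 (X × X) →ₗ.[ℂ] WithLp 2 (X × X) :=
  blockMatrix A B C (-A†)

/-- The block operator matrix with rows `(A, B)` and `(C, -A*)` is a Hamiltonian operator matrix.
Self-adjoint operators in the sense of Mathlib are automatically closed and densely defined
(`IsSelfAdjoint.isClosed`, `IsSelfAdjoint.dense_domain`). -/
structure IsHamiltonian (A B C : X →ₗ.[ℂ] X) : Prop where
  isClosed : A.IsClosed
  dense_domain : Dense (A.domain : Set X)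
  isSelfAdjoint_B : IsSelfAdjoint B
  isSelfAdjoint_C : IsSelfAdjoint C
  dense_hamiltonian : Dense ((hamiltonian A B C).domain : Set (WithLp 2 (X × X)))

/-- The operator `J H`, with domain `D(H)`. -/
def symplecticMul (H : WithLp 2 (X × X) →ₗ.[ℂ] WithLp 2 (X × X)) :
    WithLp 2 (X × X) →ₗ.[ℂ] WithLp 2 (X × X) :=
  (symplecticJ X).compPMap H

end Hilbert

end HamiltonianMatrix

end

open scoped InnerProductSpace

/-! ### A criterion for self-adjointness. -/

namespace LinearPMap

variable {E : Type*} [NormedAddCommGroup E] [InnerProductSpace ℂ E]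

/-! `JH` has rows `(C, -A*)` and `(-A, -B)`, so it is symmetric, and it is self-adjoint once `JH +
K` is onto for some everywhere defined symmetric `K`. Take `K(x, y) = (-my, -mx)` with `m` real,
which replaces `A`, `A*` by `A + m`, `A* + m`. Let `R = (A + m)⁻¹`, `P = CR`, `Q = BR*`.
Substituting `x = Ru`, `y = R*v` turns `(JH + K)(x, y) = w` into `Pu - v = w₁`, `-u - Qv = w₂`, that
is, `(1 + PQ)v = -w₁ - Pw₂`.

Accretivity gives `‖R‖ ≤ 1/|m|` and `‖AR‖ ≤ 1`, and the same for `R*` by duality. Hence `‖P‖ ‖Q‖ ≤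
(a + b/|m|)(a' + b'/|m|)`, which is below 1 for large `|m|` when `aa' < 1`; a Neumann series then
finishes. -/

/-- A densely defined symmetric operator which becomes surjective after adding an everywhere
defined symmetric operator is self-adjoint. -/
theorem eq_adjoint_of_surjective_add [CompleteSpace E] {M : E →ₗ.[ℂ] E}
    (hd : Dense (M.domain : Set E)) (hM : M.IsFormalAdjoint M) {K : E → E}
    (hK : ∀ x y, ⟪K x, y⟫_ℂ = ⟪x, K y⟫_ℂ) (hs : ∀ w, ∃ z : M.domain, M z + K z = w) :
    M = M† := by
  have hle : M ≤ M† := hM.le_adjoint hd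
  refine le_antisymm hle (le_of_le_graph ?_)
  have key : ∀ w : M†.domain, (w : E) ∈ M.domain := by
    intro w
    obtain ⟨z, hz⟩ := hs (M† w + K w)
    -- Both `w` and `z` are sent to the same vector by `M† + K`, so `w - z` is orthogonal to the
    -- range of `M + K`.
    have h : ∀ v, ⟪(w : E) - z, v⟫_ℂ = 0 := by
      intro v
      obtain ⟨z', rfl⟩ := hs v
      have h1 := adjoint_isFormalAdjoint hd w z'
      have h2 := hM z z'
      rw [inner_sub_left, inner_add_right, inner_add_right, ← h1, ← h2, ← hK, ← hK,
        ← inner_add_left, ← inner_add_left, hz, sub_self]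
    have := inner_self_eq_zero.1 (h (w - z))
    rw [sub_eq_zero.1 this]
    exact z.2
  intro p hp
  obtain ⟨w, hw1, hw2⟩ := (mem_graph_iff _).1 hp
  refine (mem_graph_iff _).2 ⟨⟨w, key w⟩, hw1, ?_⟩
  rw [← hw2]
  exact hle.2 rfl

end LinearPMap

namespace HamiltonianMatrix

variable {X : Type*} [NormedAddCommGroup X] [InnerProductSpace ℂ X]

/-! ### Resolvents of maximal accretive operators. -/

section Accretive

variable {T : X →ₗ.[ℂ] X}

/-- Expanding the square, the cross term `2l Re(Tx, x)` is nonnegative. Both resolvent estimates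
come from this. -/
theorem IsAccretive.sq_add_sq_le (hT : IsAccretive T) {l : ℝ} (hl : 0 ≤ l) (x : T.domain) :
    ‖T x‖ ^ 2 + (l * ‖(x : X)‖) ^ 2 ≤ ‖T x + (l : ℂ) • (x : X)‖ ^ 2 := by
  have h := norm_add_sq (𝕜 := ℂ) (T x) ((l : ℂ) • (x : X))
  have h1 : RCLike.re ⟪T x, (l : ℂ) • (x : X)⟫_ℂ = l * (⟪T x, (x : X)⟫_ℂ).re := by
    rw [inner_smul_right]
    simp
  rw [h1, norm_smul, Complex.norm_real, Real.norm_of_nonneg hl] at h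
  have := mul_nonneg hl (hT x)
  linarith

theorem IsAccretive.norm_apply_le (hT : IsAccretive T) {l : ℝ} (hl : 0 ≤ l) (x : T.domain) :
    ‖T x‖ ≤ ‖T x + (l : ℂ) • (x : X)‖ := by
  refine le_of_sq_le_sq ?_ (norm_nonneg _)
  nlinarith [hT.sq_add_sq_le hl x, sq_nonneg (l * ‖(x : X)‖)]

theorem IsAccretive.mul_norm_le (hT : IsAccretive T) {l : ℝ} (hl : 0 ≤ l) (x : T.domain) :
    l * ‖(x : X)‖ ≤ ‖T x + (l : ℂ) • (x : X)‖ := by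
  refine le_of_sq_le_sq ?_ (norm_nonneg _)
  nlinarith [hT.sq_add_sq_le hl x, sq_nonneg ‖T x‖]

/-- The range of `T + l` is dense when `T` is maximal accretive: a vector `z` orthogonal to it
would give the accretive extension of `T` with `z ↦ l z`. -/
theorem IsMaximalAccretive.eq_zero_of_orthogonal (hT : IsMaximalAccretive T) {l : ℝ} (hl : 0 < l)
    {z : X} (hz : ∀ x : T.domain, ⟪T x + (l : ℂ) • (x : X), z⟫_ℂ = 0) : z = 0 := by
  have hz' : ∀ x : T.domain, ⟪T x, z⟫_ℂ = -(l * ⟪(x : X), z⟫_ℂ) := by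
    intro x
    have := hz x
    rw [inner_add_left, inner_smul_left, Complex.conj_ofReal] at this
    exact eq_neg_of_add_eq_zero_left this
  by_cases hzT : z ∈ T.domain
  · have h1 := hT.1.mul_norm_le hl.le ⟨z, hzT⟩
    have h2 := hT.1 ⟨z, hzT⟩
    rw [hz' ⟨z, hzT⟩, Complex.neg_re, Complex.re_ofReal_mul] at h2
    have h3 : (⟪z, z⟫_ℂ).re = ‖z‖ ^ 2 := inner_self_eq_norm_sq (𝕜 := ℂ) z
    rw [h3] at h2
    have : ‖z‖ ^ 2 ≤ 0 := by
      by_contra! h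
      nlinarith [mul_pos hl h]
    simpa using this.antisymm (sq_nonneg _)
  · exfalso
    let S := T.supSpanSingleton z ((l : ℂ) • z) hzT
    have hS : IsAccretive S := by
      rintro ⟨w, hw⟩
      obtain ⟨x, hx, y, hy, rfl⟩ := Submodule.mem_sup.1 hw
      obtain ⟨c, rfl⟩ := Submodule.mem_span_singleton.1 hy
      have : S ⟨x + c • z, hw⟩ = T ⟨x, hx⟩ + c • ((l : ℂ) • z) :=
        LinearPMap.supSpanSingleton_apply_mk T z ((l : ℂ) • z) hzT x hx c
      rw [this]
      have e1 := hz' ⟨x, hx⟩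
      have e2 := hT.1 ⟨x, hx⟩
      have e3 : ⟪z, z⟫_ℂ = (‖z‖ : ℂ) ^ 2 := inner_self_eq_norm_sq_to_K z
      have e4 : ⟪z, x⟫_ℂ = (starRingEnd ℂ) ⟪x, z⟫_ℂ := (inner_conj_symm z x).symm
      simp only [inner_add_left, inner_add_right, inner_smul_left, inner_smul_right] at e1 e2 ⊢
      rw [e1, e3, e4]
      -- The real parts of the cross terms cancel, leaving `Re(Tx, x) + l|c|²‖z‖²`.
      have e5 : 0 ≤ l * (c.re ^ 2 + c.im ^ 2) * ‖z‖ ^ 2 := by positivity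
      simp only [← Complex.ofReal_pow, Complex.add_re, Complex.add_im, Complex.mul_re,
        Complex.mul_im, Complex.neg_re, Complex.neg_im, Complex.conj_re, Complex.conj_im, Complex.ofReal_re,
        Complex.ofReal_im]
      nlinarith
    have hle : T ≤ S := ⟨le_sup_left, fun x y hxy => by
      have : S y = T ⟨y, hxy ▸ x.2⟩ := LinearPMap.supSpanSingleton_apply_of_mem T _ hzT y _
      rw [this]
      exact congrArg T (Subtype.ext hxy)⟩
    have hST := hT.2 S hS hle
    have : z ∈ S.domain := Submodule.mem_sup_right (Submodule.mem_span_singleton_self z)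
    exact hzT (hST ▸ this)

/-- For a closed maximal accretive operator `T` and `l > 0`, the resolvent `R = (T + l)⁻¹` is
everywhere defined, with `‖R‖ ≤ l⁻¹` and `‖T R‖ ≤ 1`. -/
theorem IsMaximalAccretive.exists_resolvent [CompleteSpace X] (hT : IsMaximalAccretive T)
    (hc : T.IsClosed) {l : ℝ} (hl : 0 < l) :
    ∃ R : X →L[ℂ] X, (∀ f, (R f, f - (l : ℂ) • R f) ∈ T.graph) ∧
      (∀ x : T.domain, R (T x + (l : ℂ) • (x : X)) = x) ∧ ‖R‖ ≤ l⁻¹ ∧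
      ‖1 - (l : ℂ) • R‖ ≤ 1 := by
  have : CompleteSpace T.graph := hc.completeSpace_coe
  -- On the graph, complete because `T` is closed, `T + l` is a bounded map; being bounded below, it
  -- has closed range.
  let φ : T.graph →L[ℂ] X :=
    (ContinuousLinearMap.snd ℂ X X + (l : ℂ) • ContinuousLinearMap.fst ℂ X X) ∘L T.graph.subtypeL
  have hφ : ∀ p : T.graph, φ p = p.1.2 + (l : ℂ) • p.1.1 := fun p => rfl
  have bounds : ∀ p : T.graph, ‖p.1.2‖ ≤ ‖φ p‖ ∧ l * ‖p.1.1‖ ≤ ‖φ p‖ := by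
    intro p
    obtain ⟨x, h1, h2⟩ := (LinearPMap.mem_graph_iff _).1 p.2
    rw [hφ, ← h1, ← h2]
    exact ⟨hT.1.norm_apply_le hl.le x, hT.1.mul_norm_le hl.le x⟩
  have hanti : AntilipschitzWith (Real.toNNReal (max 1 l⁻¹)) φ := by
    refine ContinuousLinearMap.antilipschitz_of_bound φ fun p => ?_
    rw [Real.coe_toNNReal _ (by positivity)]
    obtain ⟨h1, h2⟩ := bounds p
    refine max_le ?_ ?_
    · calc ‖p.1.1‖ = l⁻¹ * (l * ‖p.1.1‖) := by field_simp
        _ ≤ l⁻¹ * ‖φ p‖ := by gcongr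
        _ ≤ _ := by gcongr; exact le_max_right _ _
    · calc ‖p.1.2‖ ≤ 1 * ‖φ p‖ := by simpa using h1
        _ ≤ _ := by gcongr; exact le_max_left _ _
  have hclosed : IsClosed (φ.range : Set X) := by
    rw [LinearMap.coe_range]
    exact hanti.isClosed_range φ.uniformContinuous
  have : CompleteSpace φ.range := hclosed.completeSpace_coe
  have htop : φ.range = ⊤ := by
    rw [← Submodule.orthogonal_eq_bot_iff, Submodule.eq_bot_iff]
    intro z hz
    refine hT.eq_zero_of_orthogonal hl fun x => ?_
    exact (Submodule.mem_orthogonal _ _).1 hz _ ⟨⟨(x, T x), T.mem_graph x⟩, rfl⟩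
  let e := ContinuousLinearEquiv.ofBijective φ (LinearMap.ker_eq_bot.2 hanti.injective) htop
  have he : ∀ f, φ (e.symm f) = f := fun f => e.apply_symm_apply f
  have he' : ∀ f, (e.symm f).1.2 = f - (l : ℂ) • (e.symm f).1.1 := fun f =>
    eq_sub_of_add_eq (he f)
  refine ⟨ContinuousLinearMap.fst ℂ X X ∘L T.graph.subtypeL ∘L (e.symm : X →L[ℂ] T.graph),
    fun f => ?_, fun x => ?_, ?_, ?_⟩
  · change ((e.symm f).1.1, f - (l : ℂ) • (e.symm f).1.1) ∈ T.graph
    rw [← he']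
    exact (e.symm f).2
  · exact congrArg (fun p : T.graph => p.1.1) (e.symm_apply_apply ⟨(x, T x), T.mem_graph x⟩)
  · refine ContinuousLinearMap.opNorm_le_bound _ (by positivity) fun f => ?_
    have := (bounds (e.symm f)).2
    rw [he] at this
    exact (le_inv_mul_iff₀ hl).2 this
  · refine ContinuousLinearMap.opNorm_le_bound _ zero_le_one fun f => ?_
    have := (bounds (e.symm f)).1
    rw [he, he'] at this
    simpa using this

/-- If `T` or `-T` is closed and maximal accretive, then for every `l > 0` one of `T + l`, `T - l`
has a bounded inverse `R` with `‖R‖ ≤ l⁻¹` and `‖T R‖ ≤ 1`. -/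
theorem exists_resolvent_of_isMaximalAccretive_or_neg [CompleteSpace X] (hc : T.IsClosed)
    (hT : IsMaximalAccretive T ∨ IsMaximalAccretive (-T)) {l : ℝ} (hl : 0 < l) :
    ∃ (m : ℝ) (R : X →L[ℂ] X), (∀ f, (R f, f - (m : ℂ) • R f) ∈ T.graph) ∧
      (∀ x : T.domain, R (T x + (m : ℂ) • (x : X)) = x) ∧ ‖R‖ ≤ l⁻¹ ∧
      ‖1 - (m : ℂ) • R‖ ≤ 1 := by
  rcases hT with hT | hT
  · exact ⟨l, hT.exists_resolvent hc hl⟩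
  · have hg : ∀ x y, (x, y) ∈ (-T).graph ↔ (x, -y) ∈ T.graph := by
      intro x y
      simp only [LinearPMap.mem_graph_iff]
      exact exists_congr fun z => and_congr_right fun _ => by
        rw [LinearPMap.neg_apply]; exact neg_eq_iff_eq_neg
    have hc' : (-T).IsClosed := by
      have h : ((-T).graph : Set (X × X)) = (fun p => (p.1, -p.2)) ⁻¹' (T.graph : Set (X × X)) :=
        Set.ext fun p => hg p.1 p.2
      rw [LinearPMap.IsClosed, h]
      exact IsClosed.preimage (by fun_prop) hc
    obtain ⟨R, h1, h2, h3, h4⟩ := hT.exists_resolvent hc' hl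
    -- `(T - l)⁻¹ = -(-T + l)⁻¹`.
    refine ⟨-l, -R, fun f => ?_, fun x => ?_, by rwa [norm_neg], by simpa using h4⟩
    · have := T.graph.neg_mem ((hg _ _).1 (h1 f))
      simpa using this
    · have := h2 x
      rw [LinearPMap.neg_apply] at this
      have e : T x + ((-l : ℝ) : ℂ) • (x : X) = -(-T x + (l : ℂ) • (x : X)) := by
        push_cast
        module
      rw [e, map_neg, neg_apply, neg_neg, this]

end Accretive

/-! ### Relative bounds. -/

theorem exists_relBoundedWith_of_relBound_lt {S T : X →ₗ.[ℂ] X} (h : IsRelBounded S T) {r : ℝ}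
    (hr : relBound S T < r) : ∃ a b : ℝ, 0 ≤ a ∧ a < r ∧ 0 ≤ b ∧ RelBoundedWith S T a b := by
  obtain ⟨a₀, b₀, ha₀, hb₀, h₀⟩ := h
  have hne : {a : ℝ | 0 ≤ a ∧ ∃ b : ℝ, 0 ≤ b ∧ RelBoundedWith S T a b}.Nonempty :=
    ⟨a₀, ha₀, b₀, hb₀, h₀⟩
  obtain ⟨a, ⟨ha, b, hb, hab⟩, har⟩ := exists_lt_of_csInf_lt hne hr
  exact ⟨a, b, ha, har, hb, hab⟩

/-- If the product of the relative bounds is less than one, constants with product less than one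
may be chosen. -/
theorem exists_relBoundedWith_mul_lt_one {S T S' T' : X →ₗ.[ℂ] X} (h : IsRelBounded S T)
    (h1 : relBound S T < 1) (h' : IsRelBounded S' T') (h1' : relBound S' T' ≤ 1) :
    ∃ a b a' b' : ℝ, 0 ≤ a ∧ 0 ≤ b ∧ 0 ≤ a' ∧ 0 ≤ b' ∧ a * a' < 1 ∧
      RelBoundedWith S T a b ∧ RelBoundedWith S' T' a' b' := by
  obtain ⟨a, b, ha, ha1, hb, hab⟩ := exists_relBoundedWith_of_relBound_lt h h1
  -- For `0 ≤ a < 1`, the number `2 / (1 + a)` exceeds 1, yet its product with `a` stays below 1.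
  have : relBound S' T' < 2 / (1 + a) := h1'.trans_lt (by rw [lt_div_iff₀] <;> linarith)
  obtain ⟨a', b', ha', ha1', hb', hab'⟩ := exists_relBoundedWith_of_relBound_lt h' this
  refine ⟨a, b, a', b', ha, hb, ha', hb', ?_, hab, hab'⟩
  rw [lt_div_iff₀ (by linarith)] at ha1'
  nlinarith

/-- The composition of a relatively bounded operator with a right inverse of a shift of the
reference operator, as an everywhere defined bounded operator. -/
theorem RelBoundedWith.exists_comp {S T : X →ₗ.[ℂ] X} {a b : ℝ} (h : RelBoundedWith S T a b)
    (ha : 0 ≤ a) (hb : 0 ≤ b) {R G : X →L[ℂ] X} (hR : ∀ f, (R f, G f) ∈ T.graph) {r : ℝ}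
    (hRn : ‖R‖ ≤ r) (hGn : ‖G‖ ≤ 1) :
    ∃ P : X →L[ℂ] X, (∀ f, (R f, P f) ∈ S.graph) ∧ ‖P‖ ≤ a + b * r := by
  obtain ⟨hd, hbd⟩ := h
  have hmem : ∀ f, R f ∈ T.domain := fun f => LinearPMap.mem_domain_of_mem_graph (hR f)
  have hTR : ∀ f, T ⟨R f, hmem f⟩ = G f := fun f =>
    LinearPMap.mem_graph_snd_inj T (T.mem_graph ⟨R f, hmem f⟩) (hR f) rfl
  let L : X →ₗ[ℂ] X := S.toFun ∘ₗ (R : X →ₗ[ℂ] X).codRestrict S.domain fun f => hd (hmem f)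
  have hL : ∀ f, ‖L f‖ ≤ (a + b * r) * ‖f‖ := by
    intro f
    calc ‖L f‖ ≤ a * ‖T ⟨R f, hmem f⟩‖ + b * ‖R f‖ := hbd ⟨R f, hmem f⟩
      _ ≤ a * (1 * ‖f‖) + b * (r * ‖f‖) := by
          rw [hTR]
          gcongr
          · exact G.le_of_opNorm_le hGn f
          · exact R.le_of_opNorm_le hRn f
      _ = _ := by ring
  have hr : 0 ≤ r := (norm_nonneg _).trans hRn
  exact ⟨L.mkContinuous _ hL, fun f => S.mem_graph ⟨R f, hd (hmem f)⟩,
    L.mkContinuous_norm_le (by positivity) hL⟩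

variable [CompleteSpace X]

/-! ### Self-adjointness of `JH`. -/

/-- Dualizing `R(A + m) = 1` on `D(A)` makes `R*` a right inverse of `A* + m`, so no accretivity of
`A*` has to be proved. -/
theorem resolvent_adjoint_mem_graph {A : X →ₗ.[ℂ] X} (hd : Dense (A.domain : Set X)) {m : ℝ}
    {R : X →L[ℂ] X}
    (hR : ∀ x : A.domain, R (A x + (m : ℂ) • (x : X)) = x) (f : X) :
    (R.adjoint f, f - (m : ℂ) • R.adjoint f) ∈ A†.graph := by
  have key : ∀ x : A.domain, ⟪f - (m : ℂ) • R.adjoint f, (x : X)⟫_ℂ = ⟪R.adjoint f, A x⟫_ℂ := by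
    intro x
    have h : ⟪f, R (A x + (m : ℂ) • (x : X))⟫_ℂ = ⟪f, (x : X)⟫_ℂ := by rw [hR]
    rw [← ContinuousLinearMap.adjoint_inner_left, inner_add_right, inner_smul_right] at h
    rw [inner_sub_left, inner_smul_left, Complex.conj_ofReal, ← h]
    ring
  exact (LinearPMap.mem_graph_iff _).2
    ⟨⟨R.adjoint f, LinearPMap.mem_adjoint_domain_of_exists _ ⟨_, key⟩⟩, rfl,
      LinearPMap.adjoint_apply_eq hd _ key⟩

theorem symplecticMul_hamiltonian_isFormalAdjoint {A B C : X →ₗ.[ℂ] X}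
    (hH : IsHamiltonian A B C) :
    (symplecticMul (hamiltonian A B C)).IsFormalAdjoint (symplecticMul (hamiltonian A B C)) := by
  have hA := LinearPMap.adjoint_isFormalAdjoint hH.dense_domain
  have hB := LinearPMap.adjoint_isFormalAdjoint hH.isSelfAdjoint_B.dense_domain
  have hC := LinearPMap.adjoint_isFormalAdjoint hH.isSelfAdjoint_C.dense_domain
  rw [LinearPMap.isSelfAdjoint_def.1 hH.isSelfAdjoint_B] at hB
  rw [LinearPMap.isSelfAdjoint_def.1 hH.isSelfAdjoint_C] at hC
  intro z w
  have e1 := hA ⟨z.1.snd, z.2.2.2⟩ ⟨w.1.fst, w.2.1.1⟩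
  have e2 := hA.symm ⟨z.1.fst, z.2.1.1⟩ ⟨w.1.snd, w.2.2.2⟩
  have e3 := hB ⟨z.1.snd, z.2.2.1⟩ ⟨w.1.snd, w.2.2.1⟩
  have e4 := hC ⟨z.1.fst, z.2.1.2⟩ ⟨w.1.fst, w.2.1.2⟩
  change ⟪C ⟨z.1.fst, z.2.1.2⟩ + -A† ⟨z.1.snd, z.2.2.2⟩, w.1.fst⟫_ℂ +
      ⟪-(A ⟨z.1.fst, z.2.1.1⟩ + B ⟨z.1.snd, z.2.2.1⟩), w.1.snd⟫_ℂ =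
    ⟪z.1.fst, C ⟨w.1.fst, w.2.1.2⟩ + -A† ⟨w.1.snd, w.2.2.2⟩⟫_ℂ +
      ⟪z.1.snd, -(A ⟨w.1.fst, w.2.1.1⟩ + B ⟨w.1.snd, w.2.2.1⟩)⟫_ℂ
  simp only [inner_add_left, inner_add_right, inner_neg_left, inner_neg_right] at e1 e2 e3 e4 ⊢
  rw [e1, e2, e3, e4]
  ring

/-- If the product of the constants in the two relative bounds is less than one, `J H` is
self-adjoint. -/
theorem symplecticMul_hamiltonian_eq_adjoint {A B C : X →ₗ.[ℂ] X} (hH : IsHamiltonian A B C)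
    (hA : IsMaximalAccretive A ∨ IsMaximalAccretive (-A)) {a b a' b' : ℝ} (ha : 0 ≤ a) (hb : 0 ≤ b)
    (ha' : 0 ≤ a') (hb' : 0 ≤ b') (haa : a * a' < 1) (hC : RelBoundedWith C A a b)
    (hB : RelBoundedWith B A† a' b') :
    symplecticMul (hamiltonian A B C) = (symplecticMul (hamiltonian A B C))† := by
  -- The product tends to `aa' < 1` as `l → ∞`.
  obtain ⟨l, hlt, hl⟩ : ∃ l : ℝ, (a + b * l⁻¹) * (a' + b' * l⁻¹) < 1 ∧ 0 < l := by
    have h : Filter.Tendsto (fun l : ℝ => (a + b * l⁻¹) * (a' + b' * l⁻¹)) Filter.atTop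
        (nhds ((a + b * 0) * (a' + b' * 0))) :=
      ((tendsto_inv_atTop_zero.const_mul b).const_add a).mul
        ((tendsto_inv_atTop_zero.const_mul b').const_add a')
    exact ((h.eventually_lt_const (by simpa using haa)).and (Filter.eventually_gt_atTop 0)).exists
  obtain ⟨m, R, hR, hR', hRn, hGn⟩ :=
    exists_resolvent_of_isMaximalAccretive_or_neg hH.isClosed hA hl
  have hRa := resolvent_adjoint_mem_graph hH.dense_domain hR'
  have hGa : ‖1 - (m : ℂ) • R.adjoint‖ ≤ 1 := by
    have : 1 - (m : ℂ) • R.adjoint = (1 - (m : ℂ) • R).adjoint := by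
      ext1 x
      refine ext_inner_right ℂ fun y => ?_
      rw [ContinuousLinearMap.adjoint_inner_left]
      change ⟪x - (m : ℂ) • R.adjoint x, y⟫_ℂ = ⟪x, y - (m : ℂ) • R y⟫_ℂ
      rw [inner_sub_left, inner_sub_right, inner_smul_left, inner_smul_right,
        Complex.conj_ofReal, ContinuousLinearMap.adjoint_inner_left]
    rw [this, LinearIsometryEquiv.norm_map]
    exact hGn
  obtain ⟨P, hP, hPn⟩ := hC.exists_comp ha hb (R := R) (G := 1 - (m : ℂ) • R) hR hRn hGn
  obtain ⟨Q, hQ, hQn⟩ := hB.exists_comp ha' hb' (R := R.adjoint) (G := 1 - (m : ℂ) • R.adjoint)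
    hRa ((LinearIsometryEquiv.norm_map _ R).trans_le hRn) hGa
  have hPQ : ‖-(P * Q)‖ < 1 := by
    rw [norm_neg]
    refine ((norm_mul_le P Q).trans ?_).trans_lt hlt
    have := (norm_nonneg _).trans hPn
    gcongr
  refine LinearPMap.eq_adjoint_of_surjective_add hH.dense_hamiltonian
    (symplecticMul_hamiltonian_isFormalAdjoint hH)
    (K := fun z => WithLp.toLp 2 (-((m : ℂ) • z.snd), -((m : ℂ) • z.fst))) ?_ ?_
  · intro z w
    change ⟪-((m : ℂ) • z.snd), w.fst⟫_ℂ + ⟪-((m : ℂ) • z.fst), w.snd⟫_ℂ =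
      ⟪z.fst, -((m : ℂ) • w.snd)⟫_ℂ + ⟪z.snd, -((m : ℂ) • w.fst)⟫_ℂ
    simp only [inner_neg_left, inner_neg_right, inner_smul_left,
      inner_smul_right, Complex.conj_ofReal]
    ring
  · intro w
    -- `N = 1 + PQ`; solve for `v` first, then read `u` off the second equation.
    let N := Units.oneSub _ hPQ
    let v : X := (N⁻¹ : (X →L[ℂ] X)ˣ).1 (-w.fst - P w.snd)
    have hv : v + P (Q v) = -w.fst - P w.snd := by
      have h := DFunLike.congr_fun N.mul_inv (-w.fst - P w.snd)
      have h' : (N : X →L[ℂ] X) v = v - -(P (Q v)) := rfl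
      rw [sub_neg_eq_add] at h'
      exact h'.symm.trans h
    clear_value v
    let u : X := -w.snd - Q v
    obtain ⟨x₁, hx₁, hAx⟩ := (LinearPMap.mem_graph_iff _).1 (hR u)
    obtain ⟨x₂, hx₂, hCx⟩ := (LinearPMap.mem_graph_iff _).1 (hP u)
    obtain ⟨y₁, hy₁, hAy⟩ := (LinearPMap.mem_graph_iff _).1 (hRa v)
    obtain ⟨y₂, hy₂, hBy⟩ := (LinearPMap.mem_graph_iff _).1 (hQ v)
    dsimp only at hx₁ hAx hx₂ hCx hy₁ hAy hy₂ hBy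
    obtain ⟨x₁, hx₁A⟩ := x₁
    obtain ⟨x₂, hx₂C⟩ := x₂
    obtain ⟨y₁, hy₁A⟩ := y₁
    obtain ⟨y₂, hy₂B⟩ := y₂
    dsimp only at hx₁ hx₂ hy₁ hy₂
    subst hx₁ hx₂ hy₁ hy₂
    -- The graph memberships supply all four domain conditions: `Ru` lies in `D(A) ∩ D(C)` and `R*v`
    -- in `D(B) ∩ D(A*)`.
    refine ⟨⟨WithLp.toLp 2 (R u, R.adjoint v), ⟨hx₁A, hx₂C⟩, ⟨hy₂B, hy₁A⟩⟩, ?_⟩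
    change WithLp.toLp 2 (C ⟨R u, hx₂C⟩ + -A† ⟨R.adjoint v, hy₁A⟩ + -((m : ℂ) • R.adjoint v),
      -(A ⟨R u, hx₁A⟩ + B ⟨R.adjoint v, hy₂B⟩) + -((m : ℂ) • R u)) = w
    rw [hAx, hCx, hAy, hBy]
    have hPu : P u = -P w.snd - P (Q v) := by simp [u]
    have e1 : P u + -(v - (m : ℂ) • R.adjoint v) + -((m : ℂ) • R.adjoint v) = w.fst := by
      rw [hPu]
      have : w.fst = -(v + P (Q v)) - P w.snd := by rw [hv]; abel
      rw [this]
      abel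
    have e2 : -(u - (m : ℂ) • R u + Q v) + -((m : ℂ) • R u) = w.snd := by
      have : u + Q v = -w.snd := sub_add_cancel _ _
      rw [← neg_eq_iff_eq_neg.2 this]
      abel
    rw [e1, e2]
    rfl

end HamiltonianMatrix

theorem corollary3p2 {X : Type*} [NormedAddCommGroup X] [InnerProductSpace ℂ X] [CompleteSpace X]
    (A B C : X →ₗ.[ℂ] X) (hH : HamiltonianMatrix.IsHamiltonian A B C)
    (hdom : (HamiltonianMatrix.hamiltonian A B C).domain =
      HamiltonianMatrix.prodSubspace A.domain A†.domain)
    (hA : HamiltonianMatrix.IsMaximalAccretive A ∨ HamiltonianMatrix.IsMaximalAccretive (-A))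
    (hbound :
      ((HamiltonianMatrix.IsRelBounded C A ∧ HamiltonianMatrix.relBound C A < 1) ∧
        (HamiltonianMatrix.IsRelBounded B A† ∧ HamiltonianMatrix.relBound B A† ≤ 1)) ∨
      ((HamiltonianMatrix.IsRelBounded C A ∧ HamiltonianMatrix.relBound C A ≤ 1) ∧
        (HamiltonianMatrix.IsRelBounded B A† ∧ HamiltonianMatrix.relBound B A† < 1))) :
    HamiltonianMatrix.symplecticMul (HamiltonianMatrix.hamiltonian A B C) =
      (HamiltonianMatrix.symplecticMul (HamiltonianMatrix.hamiltonian A B C))† := by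
  rcases hbound with ⟨⟨hC, hC1⟩, hB, hB1⟩ | ⟨⟨hC, hC1⟩, hB, hB1⟩
  · obtain ⟨a, b, a', b', ha, hb, ha', hb', haa, h, h'⟩ :=
      HamiltonianMatrix.exists_relBoundedWith_mul_lt_one hC hC1 hB hB1
    exact HamiltonianMatrix.symplecticMul_hamiltonian_eq_adjoint hH hA ha hb ha' hb' haa h h'
  · obtain ⟨a', b', a, b, ha', hb', ha, hb, haa, h', h⟩ :=
      HamiltonianMatrix.exists_relBoundedWith_mul_lt_one hB hB1 hC hC1
    rw [mul_comm] at haa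
    exact HamiltonianMatrix.symplecticMul_hamiltonian_eq_adjoint hH hA ha hb ha' hb' haa h h'
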